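/- All graphs are finite, simple and undirected, and a graph is chordal if it has no induced cycle of length greater than three. In a connected graph $G$, let $d_G(x,y)$ be the length of a shortest path from $x$ to $y$, let $\epsilon_G(x)=\max_{y\in V(G)}d_G(x,y)$ be the eccentricity of $x$, let $Rad(G)=\min_{x}\epsilon_G(x)$ and $Diam(G)=\max_{x}\epsilon_G(x)$, let $C(G)=\{x\in V(G) : \epsilon_G(x)=Rad(G)\}$, and let $\langle C(G)\rangle$, the center of $G$, be the subgraph of $G$ induced by $C(G)$. A graph is self-centered if $C(G)=V(G)$. A set $S\subseteq V(G)$ dominates $G$ if every vertex not in $S$ has a neighbor in $S$; a clique is a set of pairwise adjacent vertices. Theorem. Let $G$ be a graph with at least two vertices. Then $G$ is (isomorphic to) the center of some connected chordal graph if and only if $G$ is connected, $G$ is chordal, $Diam(G)\le 3$, and at least one of the following holds: $\langle C(G)\rangle$ is self-centered with radius two, or $G$ contains two disjoint cliques each of which dominates $G$. -/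

import Mathlib

universe u

namespace SimpleGraph

/-- A graph is chordal if it has no induced cycle of length greater than three. -/
def IsChordal {V : Type u} (G : SimpleGraph V) : Prop :=
  ∀ n : ℕ, 3 < n → ¬ (cycleGraph n).IsIndContained G

/-- A set `S` of vertices dominates `G` if every vertex not in `S` has a neighbor in `S`. -/
def Dominates {V : Type u} (G : SimpleGraph V) (S : Set V) : Prop :=
  ∀ v, v ∉ S → ∃ w ∈ S, G.Adj v w

/-- A graph is self-centered if each of its vertices belongs to its center. -/
def IsSelfCentered {V : Type u} (G : SimpleGraph V) : Prop :=
  G.center = Set.univ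

/-- `⟨C(G)⟩`: the subgraph of `G` induced by the set of vertices of minimum eccentricity. -/
abbrev centerGraph {V : Type u} (G : SimpleGraph V) : SimpleGraph G.center :=
  G.induce G.center

/-- `G` is (isomorphic to) the center of some finite connected chordal graph. -/
def IsCenterOfChordal {V : Type u} (G : SimpleGraph V) : Prop :=
  ∃ (W : Type u) (_ : Finite W) (H : SimpleGraph W),
    H.Connected ∧ H.IsChordal ∧ Nonempty (G ≃g H.centerGraph)

/-- `G` has two disjoint cliques each of which dominates `G`. -/
def HasTwoDisjointDominatingCliques {V : Type u} (G : SimpleGraph V) : Prop :=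
  ∃ A B : Set V, Disjoint A B ∧ G.IsClique A ∧ G.IsClique B ∧ G.Dominates A ∧ G.Dominates B

end SimpleGraph

/-! Necessity. Let `G` be the center of a connected chordal graph `H` of radius `r`. Balls in a
chordal graph are convex for induced paths (`IsChordal.monoConvex_ball`), so `G`, an intersection of
balls, is convex and isometric in `H`. The midpoint of a geodesic of length four in `G` would be at
distance less than `r` from every vertex of `H`; hence the diameter bound. If `G` is not complete,
every ball of radius `r - 1` in `H` meets `G` in a convex dominating set, and the Helly property of
connected sets in chordal graphs (`IsChordal.exists_clique_meeting`) finds a dominating clique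
inside it. Choosing the centers of two such balls well gives disjoint cliques, unless each central
vertex of `G` has a central non-neighbor; convexity then makes the center of `G` self-centered of
radius two.

Sufficiency is by construction, with radius three. For two disjoint dominating cliques, each gets a
new vertex joined to all of it, and that vertex gets a leaf. In the self-centered case, each central
vertex gets a leaf. Distances are bounded below by 1-Lipschitz functions (`le_edist_of_lipschitz`).
-/

/-! ### Induced paths, and the cycle formed by two routes. -/

namespace SimpleGraph

variable {V : Type u} {G : SimpleGraph V}

/-- The graph on the same vertices that keeps only the edges with both ends in `S`. -/
def within (G : SimpleGraph V) (S : Set V) : SimpleGraph V where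
  Adj a b := G.Adj a b ∧ a ∈ S ∧ b ∈ S
  symm := ⟨fun _ _ h => ⟨h.1.symm, h.2.2, h.2.1⟩⟩
  loopless := ⟨fun _ h => G.loopless.irrefl _ h.1⟩

theorem within_adj {S : Set V} {a b : V} :
    (G.within S).Adj a b ↔ G.Adj a b ∧ a ∈ S ∧ b ∈ S := Iff.rfl

theorem within_mono {S T : Set V} (h : S ⊆ T) : G.within S ≤ G.within T :=
  fun _ _ hab => ⟨hab.1, h hab.2.1, h hab.2.2⟩

theorem Reachable.within_mono {S T : Set V} {a b : V} (hr : (G.within S).Reachable a b)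
    (h : S ⊆ T) : (G.within T).Reachable a b :=
  hr.mono (SimpleGraph.within_mono h)

theorem Reachable.mem_of_within {S : Set V} {a b : V} (h : (G.within S).Reachable a b)
    (ha : a ∈ S) : b ∈ S := by
  obtain ⟨w⟩ := h
  induction w with
  | nil => exact ha
  | cons hadj _ ih => exact ih hadj.2.2

/-- The values `p 0, …, p n` are the vertices of an induced path. -/
structure IsInducedPath (G : SimpleGraph V) (p : ℕ → V) (n : ℕ) : Prop where
  inj : ∀ i ≤ n, ∀ j ≤ n, p i = p j → i = j
  adj_iff : ∀ i ≤ n, ∀ j ≤ n, (G.Adj (p i) (p j) ↔ i + 1 = j ∨ j + 1 = i)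

theorem dist_le_of_steps {p : ℕ → V} {n : ℕ} (hp : ∀ i < n, G.Adj (p i) (p (i + 1)))
    {i j : ℕ} (hij : i ≤ j) (hj : j ≤ n) :
    G.Reachable (p i) (p j) ∧ G.dist (p i) (p j) ≤ j - i := by
  suffices h : ∃ w : G.Walk (p i) (p j), w.length = j - i by
    obtain ⟨w, hw⟩ := h
    exact ⟨w.reachable, hw ▸ dist_le w⟩
  induction j, hij using Nat.le_induction with
  | base => exact ⟨Walk.nil, by simp⟩
  | succ j hij ih =>
    obtain ⟨w, hw⟩ := ih (by omega)
    exact ⟨w.concat (hp j (by omega)), by rw [Walk.length_concat, hw]; omega⟩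

theorem Reachable.exists_geodesic {x y : V} (h : G.Reachable x y) :
    ∃ p : ℕ → V, p 0 = x ∧ p (G.dist x y) = y ∧
      ∀ i j, i ≤ j → j ≤ G.dist x y → G.dist (p i) (p j) = j - i ∧ G.Reachable (p i) (p j) := by
  obtain ⟨w, hw⟩ := h.exists_walk_length_eq_dist
  have hlast : w.getVert (G.dist x y) = y := by rw [← hw, w.getVert_length]
  refine ⟨w.getVert, w.getVert_zero, hlast, ?_⟩
  have hst : ∀ i < G.dist x y, G.Adj (w.getVert i) (w.getVert (i + 1)) :=
    fun i hi => w.adj_getVert_succ (by omega)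
  intro i j hij hj
  obtain ⟨r₁, l₁⟩ := dist_le_of_steps hst (Nat.zero_le i) (by omega)
  obtain ⟨r₂, l₂⟩ := dist_le_of_steps hst hij hj
  obtain ⟨r₃, l₃⟩ := dist_le_of_steps hst hj le_rfl
  rw [w.getVert_zero] at l₁ r₁
  rw [hlast] at l₃
  refine ⟨?_, r₂⟩
  -- The three pieces of the walk have lengths at most `i`, `j - i` and the rest, so none can be
  -- shortened.
  have t₁ := r₁.dist_triangle_left (w := y)
  have t₂ := r₂.dist_triangle_left (w := y)
  omega

theorem Reachable.exists_inducedPath {x y : V} (h : G.Reachable x y) :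
    ∃ p : ℕ → V, p 0 = x ∧ p (G.dist x y) = y ∧ G.IsInducedPath p (G.dist x y) := by
  obtain ⟨p, h0, hn, hd⟩ := h.exists_geodesic
  refine ⟨p, h0, hn, ⟨fun i hi j hj hij => ?_, fun i hi j hj => ?_⟩⟩
  · rcases le_total i j with hle | hle
    · have := (hd i j hle hj).1
      rw [hij, dist_self] at this
      omega
    · have := (hd j i hle hi).1
      rw [hij, dist_self] at this
      omega
  · rcases le_total i j with hle | hle
    · rw [← dist_eq_one_iff_adj, (hd i j hle hj).1]; omega
    · rw [adj_comm, ← dist_eq_one_iff_adj, (hd j i hle hi).1]; omega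

/-- A reachable pair inside `S` is joined by an induced path of `G` with all vertices in `S`. -/
theorem exists_inducedPath_within {S : Set V} {x y : V} (hx : x ∈ S)
    (h : (G.within S).Reachable x y) :
    ∃ (p : ℕ → V) (n : ℕ), p 0 = x ∧ p n = y ∧ G.IsInducedPath p n ∧ ∀ i ≤ n, p i ∈ S := by
  obtain ⟨p, h0, hn, hp⟩ := h.exists_inducedPath
  generalize (G.within S).dist x y = n at hn hp
  have hS : ∀ i ≤ n, p i ∈ S := by
    intro i hi
    rcases Nat.eq_zero_or_pos i with rfl | hpos
    · rwa [h0]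
    · exact ((hp.adj_iff (i - 1) (by omega) i hi).2 (by omega)).2.2
  refine ⟨p, n, h0, hn, ⟨hp.inj, fun i hi j hj => ?_⟩, hS⟩
  rw [← hp.adj_iff i hi j hj, within_adj]
  simp [hS i hi, hS j hj]

theorem IsInducedPath.shift {p : ℕ → V} {n : ℕ} (hp : G.IsInducedPath p (n + 1)) :
    G.IsInducedPath (fun i => p (i + 1)) n := by
  refine ⟨fun i hi j hj h => ?_, fun i hi j hj => ?_⟩
  · have := hp.inj (i + 1) (by omega) (j + 1) (by omega) h
    omega
  · rw [hp.adj_iff (i + 1) (by omega) (j + 1) (by omega)]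
    omega

theorem reachable_within_of_steps {S : Set V} {p : ℕ → V} {i j : ℕ} (hij : i ≤ j)
    (hp : ∀ k, i ≤ k → k < j → G.Adj (p k) (p (k + 1))) (hS : ∀ k, i ≤ k → k ≤ j → p k ∈ S) :
    (G.within S).Reachable (p i) (p j) := by
  induction j, hij using Nat.le_induction with
  | base => exact Reachable.refl _
  | succ j hij ih =>
    refine (ih (fun k h1 h2 => hp k h1 (by omega)) (fun k h1 h2 => hS k h1 (by omega))).trans ?_
    exact Adj.reachable ⟨hp j hij (by omega), hS j hij (by omega), hS (j + 1) (by omega) le_rfl⟩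

theorem cycleGraph_adj_iff_val {n : ℕ} (hn : 2 < n) (i j : Fin n) :
    (cycleGraph n).Adj i j ↔ i.val + 1 = j.val ∨ j.val + 1 = i.val ∨
      (i.val = 0 ∧ j.val + 1 = n) ∨ (j.val = 0 ∧ i.val + 1 = n) := by
  have key : ∀ a b : Fin n, (a - b).val = 1 ↔ b.val + 1 = a.val ∨ (a.val = 0 ∧ b.val + 1 = n) := by
    intro a b
    have ha := a.isLt
    have hb := b.isLt
    rw [Fin.sub_def]
    simp only
    rcases le_or_gt b.val a.val with h | h
    · rw [show n - b.val + a.val = (a.val - b.val) + n by omega, Nat.add_mod_right,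
        Nat.mod_eq_of_lt (by omega)]
      omega
    · rw [Nat.mod_eq_of_lt (by omega)]
      omega
  rw [cycleGraph_adj', key, key]
  omega

/-- Two routes between `x` and `y` that have no common interior vertex and no edge between their
interiors cannot exist in a chordal graph unless `x` and `y` are equal or adjacent. -/
theorem IsChordal.eq_or_adj_of_two_routes (hG : G.IsChordal) {S T : Set V} {x y : V}
    (hxS : x ∈ S) (hxT : x ∈ T)
    (hST : ∀ z ∈ S, z ∈ T → z = x ∨ z = y)
    (hadj : ∀ s ∈ S, ∀ t ∈ T, G.Adj s t → s = x ∨ s = y ∨ t = x ∨ t = y)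
    (hS : (G.within S).Reachable x y) (hT : (G.within T).Reachable x y) :
    x = y ∨ G.Adj x y := by
  by_contra hcon
  push Not at hcon
  obtain ⟨hne, hnadj⟩ := hcon
  obtain ⟨p, a, p0, pa, hp, hpS⟩ := exists_inducedPath_within hxS hS
  obtain ⟨q, b, q0, qb, hq, hqT⟩ := exists_inducedPath_within hxT hT
  have long : ∀ {p : ℕ → V} {a : ℕ}, p 0 = x → p a = y → G.IsInducedPath p a → 2 ≤ a := by
    intro p a p0 pa hp
    by_contra hlt
    obtain rfl | rfl : a = 0 ∨ a = 1 := by omega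
    · exact hne (p0.symm.trans pa)
    · apply hnadj
      rw [← p0, ← pa, hp.adj_iff 0 (by omega) 1 le_rfl]
      exact Or.inl rfl
  have ha := long p0 pa hp
  have hb := long q0 qb hq
  have int : ∀ {p : ℕ → V} {a : ℕ}, p 0 = x → p a = y → G.IsInducedPath p a →
      ∀ i, 0 < i → i < a → p i ≠ x ∧ p i ≠ y := by
    intro p a p0 pa hp i h1 h2
    refine ⟨fun h => ?_, fun h => ?_⟩
    · have := hp.inj i h2.le 0 (by omega) (h.trans p0.symm)
      omega
    · have := hp.inj i h2.le a le_rfl (h.trans pa.symm)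
      omega
  have hpq : ∀ i ≤ a, ∀ j, 0 < j → j < b → p i ≠ q j := by
    intro i hi j hj hjb h
    have h2 := int q0 qb hq j hj hjb
    rcases hST (p i) (hpS i hi) (h ▸ hqT j hjb.le) with h3 | h3
    · exact h2.1 (h.symm.trans h3)
    · exact h2.2 (h.symm.trans h3)
  have hpqadj : ∀ i ≤ a, ∀ j, 0 < j → j < b →
      (G.Adj (p i) (q j) ↔ (i = 0 ∧ j = 1) ∨ (i = a ∧ j + 1 = b)) := by
    intro i hi j hj hjb
    rcases Nat.eq_zero_or_pos i with rfl | hi0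
    · rw [p0, ← q0, hq.adj_iff 0 (by omega) j hjb.le]
      omega
    rcases hi.eq_or_lt with rfl | hia
    · rw [pa, ← qb, hq.adj_iff b le_rfl j hjb.le]
      omega
    · refine ⟨fun h => ?_, by omega⟩
      have h1 := int p0 pa hp i hi0 hia
      have h2 := int q0 qb hq j hj hjb
      have := hadj _ (hpS i hi) _ (hqT j hjb.le) h
      tauto
  -- Along `p` from `x` to `y`, then back along the interior of `q`: an induced cycle of length `a +
  -- b`, at least four.
  let f : Fin (a + b) → V := fun i => if i.val ≤ a then p i else q (a + b - i)
  have hf : ∀ i j, (G.Adj (f i) (f j) ↔ (cycleGraph (a + b)).Adj i j) ∧ (f i = f j → i = j) := by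
    intro i j
    have hi := i.isLt
    have hj := j.isLt
    rw [cycleGraph_adj_iff_val (by omega), Fin.ext_iff]
    simp only [f]
    split_ifs with h1 h2 h2
    · exact ⟨by rw [hp.adj_iff _ h1 _ h2]; omega, hp.inj _ h1 _ h2⟩
    · refine ⟨?_, fun h => (hpq _ h1 _ (by omega) (by omega) h).elim⟩
      rw [hpqadj _ h1 _ (by omega) (by omega)]
      omega
    · refine ⟨?_, fun h => (hpq _ h2 _ (by omega) (by omega) h.symm).elim⟩
      rw [adj_comm, hpqadj _ h2 _ (by omega) (by omega)]
      omega
    · refine ⟨by rw [hq.adj_iff _ (by omega) _ (by omega)]; omega, fun h => ?_⟩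
      have := hq.inj _ (by omega) _ (by omega) h
      omega
  exact hG (a + b) (by omega)
    ⟨⟨⟨f, fun i j h => (hf i j).2 h⟩, fun {i j} => (hf i j).1⟩⟩

end SimpleGraph

/-! ### Monophonic convexity and balls of chordal graphs. -/

namespace SimpleGraph

variable {V : Type u} {G : SimpleGraph V}

/-- Monophonic convexity: the vertices of `A` with neighbors in a common connected part of the
complement of `A` form a clique. -/
def MonoConvex (G : SimpleGraph V) (A : Set V) : Prop :=
  ∀ ⦃x y x' y' : V⦄, x ∈ A → y ∈ A → G.Adj x x' → G.Adj y y' → x' ∉ A →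
    (G.within Aᶜ).Reachable x' y' → x = y ∨ G.Adj x y

/-- If the path left `A` at its first step, its start and its first return to `A` would be equal or
adjacent, which an induced path forbids. So `p 1` lies in `A`, and induction handles the rest. -/
theorem MonoConvex.inducedPath_mem {A : Set V} (hA : G.MonoConvex A) {n : ℕ} {p : ℕ → V}
    (hp : G.IsInducedPath p n) (h0 : p 0 ∈ A) (hn : p n ∈ A) : ∀ i ≤ n, p i ∈ A := by
  classical
  induction n generalizing p with
  | zero =>
    intro i hi
    rwa [Nat.le_zero.1 hi]
  | succ n ih =>
    have h1 : p 1 ∈ A := by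
      by_contra h1
      have hex : ∃ l, 1 ≤ l ∧ p l ∈ A := ⟨n + 1, by omega, hn⟩
      obtain ⟨hl, hlA⟩ := Nat.find_spec hex
      have hln : Nat.find hex ≤ n + 1 := Nat.find_min' hex ⟨by omega, hn⟩
      have hmin : ∀ k, 1 ≤ k → k < Nat.find hex → p k ∉ A :=
        fun k hk hlt hkA => Nat.find_min hex hlt ⟨hk, hkA⟩
      generalize Nat.find hex = l at hl hlA hln hmin
      have hl2 : 2 ≤ l := by
        by_contra hlt
        obtain rfl : l = 1 := by omega
        exact h1 hlA
      have hr : (G.within Aᶜ).Reachable (p 1) (p (l - 1)) :=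
        reachable_within_of_steps (by omega)
          (fun k _ _ => (hp.adj_iff k (by omega) (k + 1) (by omega)).2 (Or.inl rfl))
          (fun k hk hkl => hmin k hk (by omega))
      rcases hA h0 hlA ((hp.adj_iff 0 (by omega) 1 (by omega)).2 (Or.inl rfl))
        ((hp.adj_iff l hln (l - 1) (by omega)).2 (by omega)) h1 hr with h | h
      · have := hp.inj 0 (by omega) l hln h
        omega
      · rw [hp.adj_iff 0 (by omega) l hln] at h
        omega
    intro i hi
    rcases Nat.eq_zero_or_pos i with rfl | hi0
    · exact h0
    · have := ih hp.shift h1 hn (i - 1) (by omega)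
      rwa [show i - 1 + 1 = i by omega] at this

/-- Complements of the `A i` do not combine, but induced paths do: one from `x` to `y` through the
outside of the intersection would have its second vertex in every `A i`. -/
theorem MonoConvex.iInter {ι : Sort*} {A : ι → Set V} (hA : ∀ i, G.MonoConvex (A i)) :
    G.MonoConvex (⋂ i, A i) := by
  intro x y x' y' hx hy hxx hyy hx' hr
  by_contra hcon
  push Not at hcon
  have hy' : y' ∈ (⋂ i, A i)ᶜ := hr.mem_of_within hx'
  have hxS : x ∈ insert x (insert y (⋂ i, A i)ᶜ) := Set.mem_insert _ _
  have hyS : y ∈ insert x (insert y (⋂ i, A i)ᶜ) := Set.mem_insert_of_mem _ (Set.mem_insert _ _)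
  have hsub : (⋂ i, A i)ᶜ ⊆ insert x (insert y (⋂ i, A i)ᶜ) :=
    fun z hz => Set.mem_insert_of_mem _ (Set.mem_insert_of_mem _ hz)
  have hxy : (G.within (insert x (insert y (⋂ i, A i)ᶜ))).Reachable x y :=
    ((Adj.reachable (G := G.within _) ⟨hxx, hxS, hsub hx'⟩).trans (hr.within_mono hsub)).trans
      (Adj.reachable (G := G.within _) ⟨hyy.symm, hsub hy', hyS⟩)
  obtain ⟨p, n, p0, pn, hp, hpS⟩ := exists_inducedPath_within hxS hxy
  have hn : 2 ≤ n := by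
    by_contra hlt
    obtain rfl | rfl : n = 0 ∨ n = 1 := by omega
    · exact hcon.1 (p0.symm.trans pn)
    · apply hcon.2
      rw [← p0, ← pn, hp.adj_iff 0 (by omega) 1 le_rfl]
      exact Or.inl rfl
  have h1 : p 1 ∈ ⋂ i, A i := by
    refine Set.mem_iInter.2 fun i => (hA i).inducedPath_mem hp ?_ ?_ 1 (by omega)
    · rw [p0]; exact Set.mem_iInter.1 hx i
    · rw [pn]; exact Set.mem_iInter.1 hy i
  rcases hpS 1 (by omega) with h | h | h
  · have := hp.inj 1 (by omega) 0 (by omega) (h.trans p0.symm)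
    omega
  · have := hp.inj 1 (by omega) n le_rfl (h.trans pn.symm)
    omega
  · exact h h1

theorem Reachable.within_map {W : Type*} {H : SimpleGraph W} {A : Set W} {a b : V} (f : G ↪g H)
    (h : (G.within (f ⁻¹' A)).Reachable a b) : (H.within A).Reachable (f a) (f b) := by
  obtain ⟨w⟩ := h
  induction w with
  | nil => exact Reachable.refl _
  | cons hadj _ ih =>
    exact (Adj.reachable (G := H.within _)
      ⟨f.map_adj_iff.2 hadj.1, hadj.2.1, hadj.2.2⟩).trans ih

theorem MonoConvex.preimage {W : Type*} {H : SimpleGraph W} {A : Set W} (hA : H.MonoConvex A)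
    (f : G ↪g H) : G.MonoConvex (f ⁻¹' A) := by
  intro x y x' y' hx hy hxx hyy hx' hr
  exact (hA hx hy (f.map_adj_iff.2 hxx) (f.map_adj_iff.2 hyy) hx'
    (Reachable.within_map f hr)).imp
    (fun h => f.injective h) f.map_adj_iff.1

theorem Connected.reachable_within_ball (hG : G.Connected) {v z : V} {k : ℕ}
    (hz : G.dist v z ≤ k) :
    (G.within (insert z {w | G.dist v w < k})).Reachable v z := by
  obtain ⟨p, p0, pn, hp⟩ := (hG v z).exists_geodesic
  have h : (G.within (insert z {w | G.dist v w < k})).Reachable (p 0) (p (G.dist v z)) := by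
    refine reachable_within_of_steps (Nat.zero_le _) (fun i _ hi => ?_) (fun i _ hi => ?_)
    · rw [← dist_eq_one_iff_adj, (hp i (i + 1) (by omega) hi).1]
      omega
    · rcases hi.eq_or_lt with rfl | hlt
      · exact Or.inl pn
      · right
        have := (hp 0 i (by omega) hi).1
        rw [p0] at this
        simp only [Set.mem_ofPred_eq]
        omega
  rwa [p0, pn] at h

theorem Adj.dist_le_succ (hG : G.Connected) {v a b : V} (h : G.Adj a b) :
    G.dist v b ≤ G.dist v a + 1 := by
  have := hG.dist_triangle (u := v) (v := a) (w := b)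
  rwa [dist_eq_one_iff_adj.2 h] at this

/-- One route from `x` to `y` runs outside the ball, the other through `v` at distances less than
`k`. No edge joins their interiors, since distances from `v` change by at most one along an edge. -/
theorem IsChordal.monoConvex_ball (hch : G.IsChordal) (hG : G.Connected) (v : V) (k : ℕ) :
    G.MonoConvex {z | G.dist v z ≤ k} := by
  intro x y x' y' hx hy hxx hyy hx' hr
  have hy' : y' ∈ {z | G.dist v z ≤ k}ᶜ := hr.mem_of_within hx'
  simp only [Set.mem_ofPred_eq, Set.mem_compl_iff, not_le] at hx hy hx' hy'
  refine hch.eq_or_adj_of_two_routes (S := insert x (insert y {z | G.dist v z ≤ k}ᶜ))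
    (T := insert x (insert y {z | G.dist v z < k})) (by simp) (by simp) ?_ ?_ ?_ ?_
  · intro z hz hz'
    simp only [Set.mem_insert_iff, Set.mem_compl_iff, Set.mem_ofPred_eq] at hz hz'
    grind
  · intro s hs t ht hst
    have := Adj.dist_le_succ hG (v := v) hst.symm
    simp only [Set.mem_insert_iff, Set.mem_compl_iff, Set.mem_ofPred_eq] at hs ht
    grind
  · have hsub : {z | G.dist v z ≤ k}ᶜ ⊆ insert x (insert y {z | G.dist v z ≤ k}ᶜ) :=
      fun z hz => Set.mem_insert_of_mem _ (Set.mem_insert_of_mem _ hz)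
    exact ((Adj.reachable (G := G.within _) ⟨hxx, by simp, hsub (by simpa using hx')⟩).trans
      (hr.within_mono hsub)).trans
      (Adj.reachable (G := G.within _) ⟨hyy.symm, hsub (by simpa using hy'), by simp⟩)
  · exact ((hG.reachable_within_ball hx).symm.within_mono (by
      intro z hz; simp only [Set.mem_insert_iff] at hz ⊢; tauto)).trans
      ((hG.reachable_within_ball hy).within_mono (by
      intro z hz; simp only [Set.mem_insert_iff] at hz ⊢; tauto))

theorem Connected.exists_adj_dist_eq (hG : G.Connected) {v x : V} {k : ℕ}
    (hx : G.dist v x = k + 1) : ∃ z, G.Adj x z ∧ G.dist v z = k := by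
  obtain ⟨p, p0, pn, hp⟩ := (hG v x).exists_geodesic
  rw [hx] at pn hp
  refine ⟨p k, ?_, ?_⟩
  · rw [adj_comm, ← pn, ← dist_eq_one_iff_adj, (hp k (k + 1) (by omega) le_rfl).1]
    omega
  · rw [← p0, (hp 0 k (by omega) (by omega)).1]
    rfl

theorem IsChordal.no_induced_square (hch : G.IsChordal) {a b c d : V} (hab : G.Adj a b)
    (hbc : G.Adj b c) (hcd : G.Adj c d) (hda : G.Adj d a) :
    G.Adj a c ∨ G.Adj b d ∨ a = c ∨ b = d := by
  by_contra hcon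
  push Not at hcon
  obtain ⟨h1, h2, h3, h4⟩ := hcon
  have := hch.eq_or_adj_of_two_routes (S := {a, b, c}) (T := {a, d, c}) (x := a) (y := c)
    (by simp) (by simp) (by
      intro z hz hz'
      simp only [Set.mem_insert_iff, Set.mem_singleton_iff] at hz hz'
      grind) (by
      intro s hs t ht hst
      simp only [Set.mem_insert_iff, Set.mem_singleton_iff] at hs ht
      grind)
    ((Adj.reachable (G := G.within _) ⟨hab, by simp, by simp⟩).trans
      (Adj.reachable (G := G.within _) ⟨hbc, by simp, by simp⟩))
    ((Adj.reachable (G := G.within _) ⟨hda.symm, by simp, by simp⟩).trans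
      (Adj.reachable (G := G.within _) ⟨hcd.symm, by simp, by simp⟩))
  tauto

/-- A clique contained in a sphere of a connected chordal graph has a common neighbor one step
closer to the center of the sphere. -/
theorem IsChordal.exists_common_adj (hch : G.IsChordal) (hG : G.Connected) {v : V} {k : ℕ}
    {K : Set V} (hfin : K.Finite) (hne : K.Nonempty) (hK : G.IsClique K)
    (hd : ∀ x ∈ K, G.dist v x = k + 1) :
    ∃ z, G.dist v z = k ∧ ∀ x ∈ K, G.Adj x z := by
  have hball := hch.monoConvex_ball hG v k
  induction K, hfin using Set.Finite.induction_on with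
  | empty => exact (Set.not_nonempty_empty hne).elim
  | @insert y K hy _ ih =>
    obtain ⟨z₂, hyz₂, hz₂⟩ := hG.exists_adj_dist_eq (hd y (Set.mem_insert _ _))
    rcases K.eq_empty_or_nonempty with rfl | hKne
    · exact ⟨z₂, hz₂, by simpa using hyz₂⟩
    obtain ⟨z₁, hz₁, hKz₁⟩ := ih hKne (hK.subset (Set.subset_insert _ _))
      (fun x hx => hd x (Set.mem_insert_of_mem _ hx))
    by_cases h₁ : G.Adj y z₁
    · exact ⟨z₁, hz₁, by simpa [h₁] using hKz₁⟩
    refine ⟨z₂, hz₂, ?_⟩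
    intro x hx
    rcases hx with rfl | hx
    · exact hyz₂
    by_contra h₂
    have hxy : G.Adj x y := hK (Set.mem_insert_of_mem _ hx) (Set.mem_insert _ _)
      (fun h => hy (h ▸ hx))
    have hdx := hd x (Set.mem_insert_of_mem _ hx)
    have hdy := hd y (Set.mem_insert _ _)
    have hxb : x ∈ {z | G.dist v z ≤ k}ᶜ := by simp [hdx]
    have hyb : y ∈ {z | G.dist v z ≤ k}ᶜ := by simp [hdy]
    -- The edge `x y` lies outside the ball, so `z₁` and `z₂` coincide or are adjacent; in the
    -- latter case the square `z₁ z₂ y x` has no diagonal.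
    rcases hball (x := z₁) (y := z₂) hz₁.le hz₂.le (hKz₁ x hx).symm hyz₂.symm hxb
      (Adj.reachable (G := G.within _) ⟨hxy, hxb, hyb⟩) with h | h
    · exact h₁ (h ▸ hyz₂)
    · rcases hch.no_induced_square h hyz₂.symm hxy.symm (hKz₁ x hx) with h' | h' | h' | h'
      · exact h₁ h'.symm
      · exact h₂ h'.symm
      · rw [h', hdy] at hz₁; omega
      · rw [h', hdx] at hz₂; omega

end SimpleGraph

/-! ### Simplicial vertices and the Helly property. -/

namespace SimpleGraph

variable {V : Type u} {G : SimpleGraph V}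

/-- Dirac's theorem: in a set of vertices of a chordal graph, outside any clique that does not
exhaust the set, there is a vertex that is simplicial in the set. -/
theorem IsChordal.exists_simplicial (hch : G.IsChordal) (S : Finset V) {K : Set V}
    (hKS : ∀ k ∈ K, k ∈ S) (hK : G.IsClique K) (hne : ∃ s ∈ S, s ∉ K) :
    ∃ s ∈ S, s ∉ K ∧ G.IsClique {z | z ∈ S ∧ G.Adj s z} := by
  classical
  induction S using Finset.strongInduction generalizing K with
  | H S ih =>
  -- With `v` in `K` whenever possible, every non-neighbor of `v` other than `v` itself is outside
  -- `K`.
  obtain ⟨v, hvS, hv⟩ : ∃ v ∈ S, v ∈ K ∨ K = ∅ := by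
    rcases K.eq_empty_or_nonempty with rfl | ⟨k, hk⟩
    · obtain ⟨s, hs, _⟩ := hne
      exact ⟨s, hs, Or.inr rfl⟩
    · exact ⟨k, hKS k hk, Or.inl hk⟩
  by_cases huniv : ∀ z ∈ S, z ≠ v → G.Adj v z
  · by_cases hne' : ∃ s ∈ S.erase v, s ∉ K \ {v}
    · obtain ⟨s, hs, hsK, hcl⟩ := ih (S.erase v) (Finset.erase_ssubset hvS) (K := K \ {v})
        (fun k hk => Finset.mem_erase.2 ⟨hk.2, hKS k hk.1⟩) (hK.subset Set.sdiff_subset) hne'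
      have hsv := (Finset.mem_erase.1 hs).1
      refine ⟨s, (Finset.mem_erase.1 hs).2, fun h => hsK ⟨h, hsv⟩, ?_⟩
      intro a ha b hb hab
      by_cases hav : a = v
      · subst hav
        exact huniv b hb.1 hab.symm
      by_cases hbv : b = v
      · subst hbv
        exact (huniv a ha.1 hab).symm
      exact hcl ⟨Finset.mem_erase.2 ⟨hav, ha.1⟩, ha.2⟩ ⟨Finset.mem_erase.2 ⟨hbv, hb.1⟩, hb.2⟩ hab
    · push Not at hne'
      obtain ⟨s, hs, hsK⟩ := hne
      have hsv : s = v := by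
        by_contra h
        exact hsK (hne' s (Finset.mem_erase.2 ⟨h, hs⟩)).1
      subst hsv
      have hK0 : K = ∅ := hv.resolve_left hsK
      refine ⟨s, hs, hsK, ?_⟩
      intro a ha
      have := (hne' a (Finset.mem_erase.2 ⟨ha.2.ne', ha.1⟩)).1
      simp [hK0] at this
  · push Not at huniv
    obtain ⟨q, hqS, hqv, hvq⟩ := huniv
    -- `Q` is a component of the non-neighbors of `v`, and `T` its boundary in `S`. Routes through
    -- `v` and through `Q` make `T` a clique, so induction applies to `Q ∪ T` with `T` excluded; a
    -- vertex of `Q` has no other neighbors in `S`.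
    let R : Set V := {z | z ∈ S ∧ z ≠ v ∧ ¬ G.Adj v z}
    let Q : Set V := {z | (G.within R).Reachable q z}
    have hqR : q ∈ R := ⟨hqS, hqv, hvq⟩
    have hQR : Q ⊆ R := fun z hz => hz.mem_of_within hqR
    let T : Set V := {t | t ∈ S ∧ t ∉ Q ∧ ∃ z ∈ Q, G.Adj z t}
    have hTv : ∀ t ∈ T, G.Adj v t := by
      rintro t ⟨htS, htQ, z, hz, hzt⟩
      by_contra hvt
      have htR : t ∈ R := by
        refine ⟨htS, ?_, hvt⟩
        rintro rfl
        exact (hQR hz).2.2 hzt.symm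
      exact htQ (Reachable.trans hz (Adj.reachable (G := G.within R) ⟨hzt, hQR hz, htR⟩))
    have hQreach : ∀ z ∈ Q, (G.within Q).Reachable q z := by
      rintro z ⟨w⟩
      have : ∀ {a b : V} (w : (G.within R).Walk a b), a ∈ Q → (G.within Q).Reachable a b := by
        intro a b w
        induction w with
        | nil => intro _; exact Reachable.refl _
        | cons hadj _ ih =>
          intro ha
          have hb := Reachable.trans ha (Adj.reachable hadj)
          exact (Adj.reachable (G := G.within Q) ⟨hadj.1, ha, hb⟩).trans (ih hb)
      exact this w (Reachable.refl _)
    have hTcl : G.IsClique T := by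
      intro x hx y hy hxy
      obtain ⟨_, hxQ, x', hx', hxx⟩ := id hx
      obtain ⟨_, hyQ, y', hy', hyy⟩ := id hy
      refine (hch.eq_or_adj_of_two_routes (S := {x, v, y}) (T := insert x (insert y Q))
        (by simp) (by simp) ?_ ?_ ?_ ?_).resolve_left hxy
      · intro z hz hz'
        simp only [Set.mem_insert_iff, Set.mem_singleton_iff] at hz hz'
        have : v ∉ Q := fun h => (hQR h).2.1 rfl
        have := (hTv x hx).ne
        have := (hTv y hy).ne
        grind
      · intro s hs t ht hst
        simp only [Set.mem_insert_iff, Set.mem_singleton_iff] at hs ht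
        rcases ht with rfl | rfl | ht
        · simp
        · simp
        · have := (hQR ht).2.2
          grind
      · exact (Adj.reachable (G := G.within _) ⟨(hTv x hx).symm, by simp, by simp⟩).trans
          (Adj.reachable (G := G.within _) ⟨hTv y hy, by simp, by simp⟩)
      · have hsub : Q ⊆ insert x (insert y Q) :=
          fun z hz => Set.mem_insert_of_mem _ (Set.mem_insert_of_mem _ hz)
        exact ((Adj.reachable (G := G.within _) ⟨hxx.symm, by simp, hsub hx'⟩).trans
          (((hQreach x' hx').symm.trans (hQreach y' hy')).within_mono hsub)).trans
          (Adj.reachable (G := G.within _) ⟨hyy, hsub hy', by simp⟩)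
    have hmem : ∀ z, z ∈ S.filter (fun z => z ∈ Q ∨ z ∈ T) ↔ z ∈ S ∧ (z ∈ Q ∨ z ∈ T) :=
      fun z => Finset.mem_filter
    have hss : S.filter (fun z => z ∈ Q ∨ z ∈ T) ⊂ S := by
      refine Finset.filter_ssubset.2 ⟨v, hvS, ?_⟩
      rintro (h | h)
      · exact (hQR h).2.1 rfl
      · exact G.loopless.irrefl v (hTv v h)
    have hqQ : q ∈ Q := Reachable.refl _
    obtain ⟨s, hs, hsT, hcl⟩ := ih _ hss (K := T) (fun k hk => (hmem k).2 ⟨hk.1, Or.inr hk⟩) hTcl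
      ⟨q, (hmem q).2 ⟨hqS, Or.inl hqQ⟩, fun h => h.2.1 hqQ⟩
    have hsQ : s ∈ Q := ((hmem s).1 hs).2.resolve_right hsT
    refine ⟨s, ((hmem s).1 hs).1, ?_, ?_⟩
    · intro hsK
      rcases hv with hvK | rfl
      · exact (hQR hsQ).2.2 (hK hvK hsK (hQR hsQ).2.1.symm)
      · exact hsK
    · refine hcl.subset ?_
      rintro z ⟨hzS, hsz⟩
      refine ⟨(hmem z).2 ⟨hzS, ?_⟩, hsz⟩
      by_cases hzQ : z ∈ Q
      · exact Or.inl hzQ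
      · exact Or.inr ⟨hzS, hzQ, s, hsQ, hsz⟩

/-- An induced path cannot pass through a simplicial vertex, because its two neighbors on the path
would be adjacent. -/
theorem Reachable.within_diff_singleton {S X : Set V} {s a b : V}
    (h : (G.within X).Reachable a b) (hs : G.IsClique {z | z ∈ S ∧ G.Adj s z}) (hXS : X ⊆ S)
    (ha : a ∈ X) (has : a ≠ s) (hbs : b ≠ s) : (G.within (X \ {s})).Reachable a b := by
  obtain ⟨p, n, p0, pn, hp, hpX⟩ := exists_inducedPath_within ha h
  have hps : ∀ i ≤ n, p i ≠ s := by
    intro i hi his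
    have hi0 : i ≠ 0 := by rintro rfl; exact has (p0.symm.trans his)
    have hin : i ≠ n := by rintro rfl; exact hbs (pn.symm.trans his)
    have h1 : G.Adj s (p (i - 1)) := by
      rw [← his, hp.adj_iff i hi (i - 1) (by omega)]; omega
    have h2 : G.Adj s (p (i + 1)) := by
      rw [← his, hp.adj_iff i hi (i + 1) (by omega)]; omega
    have h3 : p (i - 1) ≠ p (i + 1) := by
      intro h
      have := hp.inj (i - 1) (by omega) (i + 1) (by omega) h
      omega
    have h4 := hs ⟨hXS (hpX (i - 1) (by omega)), h1⟩ ⟨hXS (hpX (i + 1) (by omega)), h2⟩ h3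
    rw [hp.adj_iff (i - 1) (by omega) (i + 1) (by omega)] at h4
    omega
  have := reachable_within_of_steps (G := G) (S := X \ {s}) (p := p) (Nat.zero_le n)
    (fun k _ hk => (hp.adj_iff k (by omega) (k + 1) (by omega)).2 (Or.inl rfl))
    (fun k _ hk => ⟨hpX k hk, hps k hk⟩)
  rwa [p0, pn] at this

/-- Helly property of chordal graphs: connected sets of vertices that pairwise intersect or are
joined by an edge are all met by one clique. -/
theorem IsChordal.exists_clique_meeting (hch : G.IsChordal) {ι : Type*} (S : Finset V)
    (X : ι → Set V) (hXS : ∀ i, ∀ x ∈ X i, x ∈ S) (hne : ∀ i, (X i).Nonempty)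
    (hconn : ∀ i, ∀ a ∈ X i, ∀ b ∈ X i, (G.within (X i)).Reachable a b)
    (htouch : ∀ i j, ∃ a ∈ X i, ∃ b ∈ X j, a = b ∨ G.Adj a b) :
    ∃ K : Set V, (∀ k ∈ K, k ∈ S) ∧ G.IsClique K ∧ ∀ i, (K ∩ X i).Nonempty := by
  classical
  induction S using Finset.strongInduction generalizing X with
  | H S ih =>
  rcases S.eq_empty_or_nonempty with rfl | hSne
  · refine ⟨∅, by simp, by simp, fun i => ?_⟩
    obtain ⟨x, hx⟩ := hne i
    simpa using hXS i x hx
  obtain ⟨s, hs, -, hcl⟩ := hch.exists_simplicial S (K := ∅) (by simp) (by simp)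
    (hSne.imp fun _ h => ⟨h, by simp⟩)
  have hcl' : ∀ a ∈ S, ∀ b ∈ S, (a = s ∨ G.Adj s a) → (b = s ∨ G.Adj s b) → a = b ∨ G.Adj a b := by
    intro a ha b hb has hbs
    by_cases hab : a = b
    · exact Or.inl hab
    rcases has with rfl | has
    · exact Or.inr (hbs.resolve_left (Ne.symm hab))
    rcases hbs with rfl | hbs
    · exact Or.inr has.symm
    exact Or.inr (hcl ⟨ha, has⟩ ⟨hb, hbs⟩ hab)
  -- If some set is just `s`, the closed neighborhood of `s` in `S` is the required clique.
  -- Otherwise `s` is deleted from all the sets.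
  by_cases hsing : ∃ i, X i = {s}
  · obtain ⟨i, hi⟩ := hsing
    refine ⟨{z | z ∈ S ∧ (z = s ∨ G.Adj s z)}, fun k hk => hk.1, ?_, ?_⟩
    · intro a ha b hb hab
      exact (hcl' a ha.1 b hb.1 ha.2 hb.2).resolve_left hab
    · intro j
      obtain ⟨a, ha, b, hb, hab⟩ := htouch i j
      rw [hi] at ha
      obtain rfl : a = s := ha
      exact ⟨b, ⟨hXS j b hb, hab.imp_left Eq.symm⟩, hb⟩
  · push Not at hsing
    have hne' : ∀ i, (X i \ {s}).Nonempty := by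
      intro i
      by_contra h
      rw [Set.not_nonempty_iff_eq_empty, Set.sdiff_eq_empty] at h
      exact hsing i ((hne i).subset_singleton_iff.1 h)
    -- A contact made at `s` is moved to a neighbor of `s` in the same set; it survives because the
    -- closed neighborhood of `s` is a clique.
    have hrep : ∀ i, ∀ a ∈ X i, ∃ a' ∈ X i \ {s}, a' = a ∨ (a = s ∧ G.Adj s a') := by
      intro i a ha
      by_cases has : a = s
      · subst has
        obtain ⟨c, hc, hca⟩ := hne' i
        obtain ⟨p, n, p0, pn, hp, hpX⟩ := exists_inducedPath_within ha (hconn i a ha c hc)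
        have hn : n ≠ 0 := by
          rintro rfl
          exact hca (pn.symm.trans p0)
        have hadj : G.Adj a (p 1) := by
          rw [← p0, hp.adj_iff 0 (by omega) 1 (by omega)]; omega
        exact ⟨p 1, ⟨hpX 1 (by omega), hadj.ne'⟩, Or.inr ⟨rfl, hadj⟩⟩
      · exact ⟨a, ⟨ha, has⟩, Or.inl rfl⟩
    obtain ⟨K, hKS, hK, hKX⟩ := ih (S.erase s) (Finset.erase_ssubset hs) (fun i => X i \ {s})
      (fun i x hx => Finset.mem_erase.2 ⟨hx.2, hXS i x hx.1⟩) hne'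
      (fun i a ha b hb => (hconn i a ha.1 b hb.1).within_diff_singleton hcl (hXS i) ha.1 ha.2
        hb.2) (by
        intro i j
        obtain ⟨a, ha, b, hb, hab⟩ := htouch i j
        obtain ⟨a', ha', haa⟩ := hrep i a ha
        obtain ⟨b', hb', hbb⟩ := hrep j b hb
        refine ⟨a', ha', b', hb', ?_⟩
        have hmem := hcl' a' (hXS i a' ha'.1) b' (hXS j b' hb'.1)
        rcases haa with rfl | ⟨rfl, haa⟩
        · rcases hbb with rfl | ⟨rfl, hbb⟩
          · exact hab
          · exact hmem (hab.imp id Adj.symm) (Or.inr hbb)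
        · rcases hbb with rfl | ⟨rfl, hbb⟩
          · exact hmem (Or.inr haa) (hab.imp Eq.symm id)
          · exact hmem (Or.inr haa) (Or.inr hbb))
    exact ⟨K, fun k hk => Finset.mem_of_mem_erase (hKS k hk), hK,
      fun i => (hKX i).mono fun z hz => ⟨hz.1, hz.2.1⟩⟩

end SimpleGraph

/-! ### Dominating cliques and the center of a chordal graph. -/

namespace SimpleGraph

variable {V : Type u} {G : SimpleGraph V}

theorem Connected.exists_path_of_dist_le_three (hG : G.Connected) {x y : V} (h : G.dist x y ≤ 3) :
    ∃ p q, (p = x ∨ G.Adj p x) ∧ (p = q ∨ G.Adj p q) ∧ (q = y ∨ G.Adj q y) := by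
  obtain ⟨p, p0, pn, hp⟩ := (hG x y).exists_inducedPath
  generalize G.dist x y = n at *
  have key : ∀ i ≤ n, ∀ j ≤ n, i ≤ j + 1 → j ≤ i + 1 → p i = p j ∨ G.Adj (p i) (p j) := by
    intro i hi j hj h1 h2
    by_cases hij : i = j
    · exact Or.inl (congrArg p hij)
    · exact Or.inr ((hp.adj_iff i hi j hj).2 (by omega))
  refine ⟨p (min 1 n), p (min 2 n), ?_, key _ (by omega) _ (by omega) (by omega) (by omega), ?_⟩
  · rw [← p0]
    exact key _ (by omega) _ (by omega) (by omega) (by omega)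
  · rw [← pn]
    exact key _ (by omega) _ (by omega) (by omega) (by omega)

/-- In a chordal graph of diameter at most three, every dominating convex set of vertices contains
a dominating clique. -/
theorem IsChordal.exists_dominating_clique [Finite V] (hch : G.IsChordal) (hG : G.Connected)
    (hd : ∀ x y, G.dist x y ≤ 3) {A : Set V} (hA : G.MonoConvex A) (hdom : G.Dominates A) :
    ∃ K ⊆ A, G.IsClique K ∧ G.Dominates K := by
  classical
  have := Fintype.ofFinite V
  -- A clique meeting the trace on `A` of every closed neighborhood dominates `G` after intersection
  -- with `A`. Convexity makes each trace connected, and the diameter bound makes any two touch.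
  let X : V → Set V := fun x => {a | a ∈ A ∧ (a = x ∨ G.Adj a x)}
  have hne : ∀ x, (X x).Nonempty := by
    intro x
    by_cases hx : x ∈ A
    · exact ⟨x, hx, Or.inl rfl⟩
    · obtain ⟨w, hw, hxw⟩ := hdom x hx
      exact ⟨w, hw, Or.inr hxw.symm⟩
  have hconn : ∀ x, ∀ a ∈ X x, ∀ b ∈ X x, (G.within (X x)).Reachable a b := by
    intro x a ha b hb
    by_cases hx : x ∈ A
    · have hxX : x ∈ X x := ⟨hx, Or.inl rfl⟩
      have : ∀ c ∈ X x, (G.within (X x)).Reachable c x := by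
        intro c hc
        obtain ⟨-, rfl | h⟩ := id hc
        · exact Reachable.refl _
        · exact Adj.reachable (G := G.within _) ⟨h, hc, hxX⟩
      exact (this a ha).trans (this b hb).symm
    · have hax : G.Adj a x := ha.2.resolve_left (by rintro rfl; exact hx ha.1)
      have hbx : G.Adj b x := hb.2.resolve_left (by rintro rfl; exact hx hb.1)
      rcases hA ha.1 hb.1 hax hbx hx (Reachable.refl _) with rfl | h
      · exact Reachable.refl _
      · exact Adj.reachable (G := G.within _) ⟨h, ha, hb⟩
  -- A path of length at most three that leaves `A` is replaced by its points of attachment to `A`,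
  -- which convexity makes equal or adjacent.
  have hout : ∀ y q, q ∉ A → (q = y ∨ G.Adj q y) →
      ∃ q' ∈ X y, ∃ z, G.Adj q' z ∧ (G.within Aᶜ).Reachable q z := by
    intro y q hq hqy
    by_cases hy : y ∈ A
    · have hqy' : G.Adj q y := hqy.resolve_left (by rintro rfl; exact hq hy)
      exact ⟨y, ⟨hy, Or.inl rfl⟩, q, hqy'.symm, Reachable.refl _⟩
    · obtain ⟨w, hw, hyw⟩ := hdom y hy
      refine ⟨w, ⟨hw, Or.inr hyw.symm⟩, y, hyw.symm, ?_⟩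
      rcases hqy with rfl | h
      · exact Reachable.refl _
      · exact Adj.reachable (G := G.within _) ⟨h, hq, hy⟩
  have htouch : ∀ x y, ∃ a ∈ X x, ∃ b ∈ X y, a = b ∨ G.Adj a b := by
    intro x y
    obtain ⟨p, q, hpx, hpq, hqy⟩ := hG.exists_path_of_dist_le_three (hd x y)
    by_cases hp : p ∈ A
    · by_cases hq : q ∈ A
      · exact ⟨p, ⟨hp, hpx⟩, q, ⟨hq, hqy⟩, hpq⟩
      · obtain ⟨q', hq', z, hqz, hr⟩ := hout y q hq hqy
        have hpq' : G.Adj p q := hpq.resolve_left (by rintro rfl; exact hq hp)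
        exact ⟨p, ⟨hp, hpx⟩, q', hq', hA hp hq'.1 hpq' hqz hq hr⟩
    · obtain ⟨p', hp', z, hpz, hr⟩ := hout x p hp hpx
      have hz : z ∉ A := hr.mem_of_within hp
      by_cases hq : q ∈ A
      · have hpq' : G.Adj p q := hpq.resolve_left (by rintro rfl; exact hp hq)
        exact ⟨p', hp', q, ⟨hq, hqy⟩, hA hp'.1 hq hpz hpq'.symm hz hr.symm⟩
      · obtain ⟨q', hq', z', hqz, hr'⟩ := hout y q hq hqy
        have hpq' : (G.within Aᶜ).Reachable p q := by
          rcases hpq with rfl | h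
          · exact Reachable.refl _
          · exact Adj.reachable (G := G.within _) ⟨h, hp, hq⟩
        exact ⟨p', hp', q', hq', hA hp'.1 hq'.1 hpz hqz hz (hr.symm.trans (hpq'.trans hr'))⟩
  obtain ⟨K, -, hK, hKX⟩ := hch.exists_clique_meeting Finset.univ X (by simp) hne hconn htouch
  refine ⟨K ∩ A, Set.inter_subset_right, hK.subset Set.inter_subset_left, ?_⟩
  intro x hx
  obtain ⟨a, haK, haA, hax⟩ := hKX x
  refine ⟨a, ⟨haK, haA⟩, (hax.resolve_left ?_).symm⟩
  rintro rfl
  exact hx ⟨haK, haA⟩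

theorem Dominates.nonempty [Nonempty V] {K : Set V} (h : G.Dominates K) : K.Nonempty := by
  by_contra hK
  rw [Set.not_nonempty_iff_eq_empty] at hK
  subst hK
  obtain ⟨w, hw, -⟩ := h (Classical.arbitrary V) (by simp)
  exact hw

theorem Dominates.edist_le_two {K : Set V} (h : G.Dominates K) (hK : G.IsClique K) {k : V}
    (hk : k ∈ K) (y : V) : G.edist k y ≤ 2 := by
  have h1 : ∀ w ∈ K, G.edist k w ≤ 1 := by
    intro w hw
    rw [edist_le_one_iff_adj_or_eq, or_iff_not_imp_right]
    exact hK hk hw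
  by_cases hy : y ∈ K
  · exact (h1 y hy).trans (by norm_num)
  · obtain ⟨w, hw, hyw⟩ := h y hy
    calc G.edist k y ≤ G.edist k w + G.edist w y := SimpleGraph.edist_triangle
      _ ≤ 1 + 1 := add_le_add (h1 w hw) (edist_eq_one_iff_adj.2 hyw.symm).le
      _ = 2 := by norm_num

theorem center_eq_iInter [Nonempty V] (hG : G.Connected) {r : ℕ} (hr : G.radius = r) :
    G.center = ⋂ v, {z | G.dist v z ≤ r} := by
  ext z
  rw [mem_center_iff, hr, Set.mem_iInter]
  have h1 : (r : ℕ∞) ≤ G.eccent z := hr ▸ radius_le_eccent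
  rw [← h1.ge_iff_eq', eccent_le_iff]
  refine forall_congr' fun v => ?_
  rw [Set.mem_ofPred_eq, dist_comm, ← (hG z v).coe_dist_eq_edist]
  exact Nat.cast_le

/-- The center is convex, so a common neighbor of two nonadjacent central vertices is central:
distance two is also attained inside the center. -/
theorem IsChordal.centerGraph_selfCentered [Nonempty V] (hch : G.IsChordal) (hG : G.Connected)
    (hrad : G.radius = 2) (h : ∀ c ∈ G.center, ∃ c' ∈ G.center, c ≠ c' ∧ ¬ G.Adj c c') :
    G.centerGraph.IsSelfCentered ∧ G.centerGraph.radius = 2 := by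
  have hconv : G.MonoConvex G.center := by
    rw [center_eq_iInter hG (r := 2) hrad]
    exact MonoConvex.iInter fun v => hch.monoConvex_ball hG v 2
  have hecc : ∀ c, G.centerGraph.eccent c = 2 := by
    intro c
    apply le_antisymm
    · rw [eccent_le_iff]
      intro c'
      by_cases h1 : G.Adj c c' ∨ c = c'
      · exact (edist_le_one_iff_adj_or_eq.2 (h1.imp_left fun h => h)).trans (by norm_num)
      push Not at h1
      have hne : (c : V) ≠ c' := fun h => h1.2 (Subtype.ext h)
      have hle : G.edist c c' ≤ 2 := by
        rw [← hrad, ← (mem_center_iff _).1 c.2]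
        exact edist_le_eccent
      have hcommon : (G.commonNeighbors c c').Nonempty := by
        by_contra hemp
        rw [Set.not_nonempty_iff_eq_empty] at hemp
        exact hle.not_gt (two_lt_edist_iff.2 ⟨hne, h1.1, hemp⟩)
      obtain ⟨m, hcm, hcm'⟩ := hcommon
      have hm : m ∈ G.center := by
        by_contra hm
        rcases hconv c.2 c'.2 hcm hcm' hm (Reachable.refl _) with h | h
        · exact hne h
        · exact h1.1 h
      exact (edist_eq_two_iff.2 ⟨h1.2, h1.1, ⟨m, hm⟩, hcm, hcm'⟩).le
    · by_contra hlt
      rw [not_le] at hlt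
      have hle : G.centerGraph.eccent c ≤ 1 := by
        rw [← one_add_one_eq_two] at hlt
        exact Order.le_of_lt_add_one hlt
      obtain ⟨c', hc', hne, hnadj⟩ := h c c.2
      exact hnadj ((eccent_le_one_iff c).1 hle ⟨c', hc'⟩ fun h => hne (congrArg Subtype.val h))
  have hcne : Nonempty G.center := G.center_nonempty.to_subtype
  have hr : G.centerGraph.radius = 2 := by
    obtain ⟨c, hc⟩ := G.centerGraph.exists_eccent_eq_radius
    rw [← hc, hecc]
  exact ⟨Set.eq_univ_of_forall fun c => (mem_center_iff c).2 ((hecc c).trans hr.symm), hr⟩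

end SimpleGraph

/-! ### Necessity: properties of the center of a chordal graph. -/

namespace SimpleGraph

variable {V W : Type u} {G : SimpleGraph V} {H : SimpleGraph W} {f : G ↪g H} {r : ℕ}

/-- A shortest path of `H` is induced, hence stays in the convex range and pulls back to `G`. -/
theorem MonoConvex.reachable_and_dist_eq (hconv : H.MonoConvex (Set.range f))
    (hH : H.Connected) (x y : V) : G.Reachable x y ∧ G.dist x y = H.dist (f x) (f y) := by
  obtain ⟨p, p0, pn, hp⟩ := (hH (f x) (f y)).exists_inducedPath
  have hmem := hconv.inducedPath_mem hp ⟨x, p0.symm⟩ ⟨y, pn.symm⟩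
  have : ∀ i, ∃ z, i ≤ H.dist (f x) (f y) → f z = p i := by
    intro i
    by_cases hi : i ≤ H.dist (f x) (f y)
    · exact (hmem i hi).imp fun _ h _ => h
    · exact ⟨x, fun h => (hi h).elim⟩
  choose q hq using this
  have hst : ∀ i < H.dist (f x) (f y), G.Adj (q i) (q (i + 1)) := by
    intro i hi
    rw [← f.map_adj_iff, hq i hi.le, hq (i + 1) hi, hp.adj_iff i hi.le (i + 1) hi]
    exact Or.inl rfl
  have hres := dist_le_of_steps hst (Nat.zero_le _) le_rfl
  rw [f.injective ((hq 0 (Nat.zero_le _)).trans p0),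
    f.injective ((hq _ le_rfl).trans pn)] at hres
  refine ⟨hres.1, le_antisymm hres.2 ?_⟩
  obtain ⟨w, hw⟩ := hres.1.exists_walk_length_eq_dist
  rw [← hw, ← w.length_map f.toHom]
  exact dist_le _

/-- Serves each half of a geodesic of length four with midpoint `b`: near its end `x` the ball has a
vertex attached to the outside component of `b`. If `x` and `a` are both outside, it is a common
neighbor of theirs one level down. -/
theorem Connected.exists_adj_ball (hH : H.Connected) (hch : H.IsChordal) {v a b x : W} {k : ℕ}
    (hxa : H.Adj x a) (hab : H.Adj a b) (hx : H.dist v x ≤ k + 1) (ha : H.dist v a ≤ k + 1)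
    (hb : ¬ H.dist v b ≤ k) :
    ∃ c c', H.dist v c ≤ k ∧ H.Adj c c' ∧ ¬ H.dist v c' ≤ k ∧
      (H.within {z | H.dist v z ≤ k}ᶜ).Reachable c' b ∧ H.dist c x ≤ 1 := by
  by_cases ha' : H.dist v a ≤ k
  · exact ⟨a, b, ha', hab, hb, Reachable.refl _, (dist_eq_one_iff_adj.2 hxa.symm).le⟩
  have hr : (H.within {z | H.dist v z ≤ k}ᶜ).Reachable a b :=
    Adj.reachable (G := H.within _) ⟨hab, ha', hb⟩
  by_cases hx' : H.dist v x ≤ k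
  · exact ⟨x, a, hx', hxa, ha', hr, by simp⟩
  obtain ⟨c, hc, hcx⟩ := hch.exists_common_adj hH (v := v) (k := k) (K := {x, a})
    (Set.toFinite _) ⟨x, by simp⟩ (by simpa [isClique_insert] using fun _ => hxa) (by
      intro z hz
      rcases hz with rfl | rfl <;> omega)
  exact ⟨c, a, hc.le, (hcx a (by simp)).symm, ha', hr,
    (dist_eq_one_iff_adj.2 (hcx x (by simp)).symm).le⟩

/-- The midpoint of a shortest path of length four is strictly closer to any vertex than the
farthest vertex of the path. -/
theorem IsChordal.dist_midpoint_le (hch : H.IsChordal) (hH : H.Connected) {v x a b c y : W} {k : ℕ}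
    (hxa : H.Adj x a) (hab : H.Adj a b) (hbc : H.Adj b c) (hcy : H.Adj c y)
    (hxy : 4 ≤ H.dist x y)
    (hx : H.dist v x ≤ k + 1) (ha : H.dist v a ≤ k + 1) (hc : H.dist v c ≤ k + 1)
    (hy : H.dist v y ≤ k + 1) : H.dist v b ≤ k := by
  by_contra hb
  obtain ⟨p, p', hp, hpp, hp', hpr, hpx⟩ := hH.exists_adj_ball hch hxa hab hx ha hb
  obtain ⟨q, q', hq, hqq, hq', hqr, hqy⟩ := hH.exists_adj_ball hch hcy.symm hbc.symm hy hc hb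
  -- Both `p` and `q` attach to the outside component of `b`, so `x` and `y` would be at distance at
  -- most three.
  have hpq : H.dist p q ≤ 1 := by
    rcases hch.monoConvex_ball hH v k hp hq hpp hqq hp' (hpr.trans hqr.symm) with h | h
    · simp [h]
    · exact (dist_eq_one_iff_adj.2 h).le
  have t1 := hH.dist_triangle (u := x) (v := p) (w := y)
  have t2 := hH.dist_triangle (u := p) (v := q) (w := y)
  rw [dist_comm] at hpx
  omega

theorem Reachable.exists_exit {A : Set V} {a b : V} (h : G.Reachable a b) (ha : a ∉ A)
    (hb : b ∈ A) : ∃ c d, c ∉ A ∧ d ∈ A ∧ G.Adj c d ∧ (G.within Aᶜ).Reachable a c := by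
  obtain ⟨w⟩ := h
  induction w with
  | nil => exact (ha hb).elim
  | @cons a e b hadj w ih =>
    by_cases he : e ∈ A
    · exact ⟨a, e, ha, he, hadj, Reachable.refl _⟩
    · obtain ⟨c, d, hc, hd, hcd, hr⟩ := ih he hb
      exact ⟨c, d, hc, hd, hcd, (Adj.reachable (G := G.within _) ⟨hadj, ha, he⟩).trans hr⟩

/-- The embedding `f` identifies `G` with the center of `H`, and `H` has radius `r`. -/
structure IsCenterEmbedding (f : G ↪g H) (r : ℕ) : Prop where
  dist_le : ∀ x v, H.dist v (f x) ≤ r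
  exists_dist_eq : ∀ x, ∃ v, H.dist v (f x) = r
  exists_lt_dist : ∀ z, z ∉ Set.range f → ∃ v, r < H.dist v z

theorem exists_isCenterEmbedding [Finite W] (hH : H.Connected) (e : G ≃g H.centerGraph) :
    ∃ (f : G ↪g H) (r : ℕ), IsCenterEmbedding f r := by
  have := hH.nonempty
  obtain ⟨r, hr⟩ := ENat.ne_top_iff_exists.1 (radius_ne_top_iff.2 hH)
  have hcoe : ∀ v z, H.edist z v = H.dist v z := by
    intro v z
    rw [dist_comm, (hH z v).coe_dist_eq_edist]
  let f : G ↪g H := (Embedding.induce H.center).comp e.toEmbedding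
  have hf : ∀ x, H.eccent (f x) = r := by
    intro x
    rw [hr]
    exact (e x).2
  refine ⟨f, r, ⟨fun x v => ?_, fun x => ?_, fun z hz => ?_⟩⟩
  · have := edist_le_eccent (G := H) (u := f x) (v := v)
    rw [hf, hcoe] at this
    exact_mod_cast this
  · obtain ⟨v, hv⟩ := H.exists_edist_eq_eccent_of_finite (f x)
    rw [hf, hcoe] at hv
    exact ⟨v, by exact_mod_cast hv⟩
  · obtain ⟨v, hv⟩ := H.exists_edist_eq_eccent_of_finite z
    refine ⟨v, ?_⟩
    have hzc : z ∉ H.center := by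
      intro hzc
      refine hz ⟨e.symm ⟨z, hzc⟩, ?_⟩
      change ((e (e.symm ⟨z, hzc⟩) : H.center) : W) = z
      rw [e.apply_symm_apply]
    have hlt : H.radius < H.eccent z :=
      lt_of_le_of_ne radius_le_eccent fun h => hzc ((mem_center_iff z).2 h.symm)
    rw [← hv, ← hr, hcoe] at hlt
    exact_mod_cast hlt

namespace IsCenterEmbedding

theorem monoConvex_range (hf : IsCenterEmbedding f r) (hch : H.IsChordal) (hH : H.Connected) :
    H.MonoConvex (Set.range f) := by
  have : Set.range f = ⋂ v, {z | H.dist v z ≤ r} := by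
    ext z
    rw [Set.mem_iInter]
    constructor
    · rintro ⟨x, rfl⟩ v
      exact hf.dist_le x v
    · intro h
      by_contra hz
      obtain ⟨v, hv⟩ := hf.exists_lt_dist z hz
      exact (h v).not_gt hv
  rw [this]
  exact MonoConvex.iInter fun v => hch.monoConvex_ball hH v r

theorem dist_le_three (hf : IsCenterEmbedding f r) (hch : H.IsChordal) (hH : H.Connected)
    (x y : V) : G.dist x y ≤ 3 := by
  have hiso := (hf.monoConvex_range hch hH).reachable_and_dist_eq hH
  by_contra hlt
  obtain ⟨p, -, -, hp⟩ := (hiso x y).1.exists_geodesic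
  have hadj : ∀ i < 4, H.Adj (f (p i)) (f (p (i + 1))) := by
    intro i hi
    rw [f.map_adj_iff, ← dist_eq_one_iff_adj, (hp i (i + 1) (by omega) (by omega)).1]
    omega
  have hd4 : H.dist (f (p 0)) (f (p 4)) = 4 := by
    rw [← (hiso _ _).2, (hp 0 4 (by omega) (by omega)).1]
  obtain ⟨k, rfl⟩ : ∃ k, r = k + 1 := by
    have := hf.dist_le (p 4) (f (p 0))
    exact ⟨r - 1, by omega⟩
  obtain ⟨v, hv⟩ := hf.exists_dist_eq (p 2)
  have : H.dist v (f (p 2)) ≤ k := hch.dist_midpoint_le hH (hadj 0 (by omega)) (hadj 1 (by omega))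
    (hadj 2 (by omega)) (hadj 3 (by omega)) hd4.ge (hf.dist_le _ v) (hf.dist_le _ v)
    (hf.dist_le _ v) (hf.dist_le _ v)
  omega

/-- If the center is not a clique, then its vertices at distance less than the radius from a given
vertex dominate it. -/
theorem dominates (hf : IsCenterEmbedding f (r + 1)) (hch : H.IsChordal) (hH : H.Connected)
    {x₀ y₀ : V} (hne : x₀ ≠ y₀) (hnadj : ¬ G.Adj x₀ y₀) (v : W) :
    G.Dominates (f ⁻¹' {z | H.dist v z ≤ r}) := by
  have hconv := hf.monoConvex_range hch hH
  have hiso := hconv.reachable_and_dist_eq hH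
  have hball := hch.monoConvex_ball hH v r
  have hcloser : ∀ x, x ∉ f ⁻¹' {z | H.dist v z ≤ r} → ∃ κ, H.Adj (f x) κ ∧ H.dist v κ = r := by
    intro x hx
    refine hH.exists_adj_dist_eq (le_antisymm (hf.dist_le x v) ?_)
    simp only [Set.mem_preimage, Set.mem_ofPred_eq, not_le] at hx
    omega
  intro z hz
  by_contra hcon
  push Not at hcon
  by_cases hex : ∃ z₁, z₁ ∈ f ⁻¹' {z | H.dist v z ≤ r}
  · obtain ⟨z₁, hz₁⟩ := hex
    obtain ⟨c, d, hc, hd, hcd, hr⟩ := (hiso z z₁).1.exists_exit hz hz₁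
    obtain ⟨κ, hzκ, hκ⟩ := hcloser z hz
    -- Convexity is used twice: the ball makes `κ` adjacent to `d`, and then the center, with `κ`
    -- outside it, makes `z` equal or adjacent to `d`.
    have hκr : κ ∉ Set.range f := by
      rintro ⟨k, rfl⟩
      exact hcon k hκ.le (f.map_adj_iff.1 hzκ)
    have hκd : H.Adj κ (f d) := by
      refine (hball hκ.le hd hzκ.symm (f.map_adj_iff.2 hcd.symm) hz
        (Reachable.within_map (A := {z | H.dist v z ≤ r}ᶜ) f hr)).resolve_left ?_
      rintro rfl
      exact hκr ⟨d, rfl⟩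
    rcases hconv ⟨z, rfl⟩ ⟨d, rfl⟩ hzκ hκd.symm hκr (Reachable.refl _) with h | h
    · exact hz (f.injective h ▸ hd)
    · exact hcon d hd (f.map_adj_iff.1 h)
  -- If the ball missed the center, `x₀` and `y₀` would have equal or adjacent neighbors outside the
  -- center, contradicting its convexity.
  · push Not at hex
    obtain ⟨κ, hxκ, hκ⟩ := hcloser x₀ (hex x₀)
    obtain ⟨μ, hyμ, hμ⟩ := hcloser y₀ (hex y₀)
    have hκr : ∀ κ, H.dist v κ = r → κ ∉ Set.range f := by
      rintro _ h ⟨k, rfl⟩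
      exact hex k h.le
    have hr : (G.within (f ⁻¹' {z | H.dist v z ≤ r}ᶜ)).Reachable x₀ y₀ :=
      (hiso x₀ y₀).1.mono fun a b h => ⟨h, hex a, hex b⟩
    have hκμ : (H.within (Set.range f)ᶜ).Reachable κ μ := by
      rcases hball hκ.le hμ.le hxκ.symm hyμ.symm (hex x₀) (Reachable.within_map f hr) with h | h
      · rw [h]
      · exact Adj.reachable (G := H.within _) ⟨h, hκr κ hκ, hκr μ hμ⟩
    rcases hconv ⟨x₀, rfl⟩ ⟨y₀, rfl⟩ hxκ hyμ (hκr κ hκ) hκμ with h | h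
    · exact hne (f.injective h)
    · exact hnadj (f.map_adj_iff.1 h)

theorem selfCentered_or_cliques [Finite V] [Nontrivial V] (hf : IsCenterEmbedding f r)
    (hch : H.IsChordal) (hH : H.Connected) (hGch : G.IsChordal) (hG : G.Connected) :
    (G.centerGraph.IsSelfCentered ∧ G.centerGraph.radius = 2) ∨
      G.HasTwoDisjointDominatingCliques := by
  have hd3 := hf.dist_le_three hch hH
  have huniv : ∀ u, (∀ y, u ≠ y → G.Adj u y) → G.Dominates {u} := by
    intro u hu y hy
    exact ⟨u, rfl, (hu y fun h => hy h.symm).symm⟩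
  by_cases hcomplete : ∀ x y, x ≠ y → G.Adj x y
  · right
    obtain ⟨a, b, hab⟩ := exists_pair_ne V
    exact ⟨{a}, {b}, by simpa using hab, isClique_singleton a, isClique_singleton b,
      huniv a (hcomplete a), huniv b (hcomplete b)⟩
  push Not at hcomplete
  obtain ⟨x₀, y₀, hne, hnadj⟩ := hcomplete
  obtain ⟨k, rfl⟩ : ∃ k, r = k + 1 + 1 := by
    have h1 := hf.dist_le y₀ (f x₀)
    have h2 := hH.one_lt_dist_of_ne_of_not_adj (f.injective.ne hne) (f.map_adj_iff.not.2 hnadj)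
    exact ⟨r - 2, by omega⟩
  have hclique : ∀ v, ∃ K ⊆ f ⁻¹' {z | H.dist v z ≤ k + 1}, G.IsClique K ∧ G.Dominates K :=
    fun v => hGch.exists_dominating_clique hG hd3 ((hch.monoConvex_ball hH v (k + 1)).preimage f)
      (hf.dominates hch hH hne hnadj v)
  by_cases hu : ∃ u, ∀ y, u ≠ y → G.Adj u y
  · right
    obtain ⟨u, hu⟩ := hu
    obtain ⟨v, hv⟩ := hf.exists_dist_eq u
    obtain ⟨K, hKv, hK, hKd⟩ := hclique v
    refine ⟨{u}, K, ?_, isClique_singleton u, hK, huniv u hu, hKd⟩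
    rw [Set.disjoint_singleton_left]
    intro huK
    have : H.dist v (f u) ≤ k + 1 := hKv huK
    omega
  push Not at hu
  have htwo : ∀ u, 2 ≤ G.eccent u := by
    intro u
    by_contra hlt
    rw [not_le, ← one_add_one_eq_two] at hlt
    obtain ⟨y, huy, hnuy⟩ := hu u
    exact hnuy ((eccent_le_one_iff u).1 (Order.le_of_lt_add_one hlt) y huy)
  have hdomecc : ∀ K : Set V, G.Dominates K → G.IsClique K → ∀ k ∈ K, G.eccent k = 2 :=
    fun K hKd hK k hk =>
      le_antisymm ((eccent_le_iff _ _).2 (hKd.edist_le_two hK hk)) (htwo k)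
  have hrad : G.radius = 2 := by
    obtain ⟨c, hc⟩ := G.exists_eccent_eq_radius
    refine le_antisymm ?_ (hc ▸ htwo c)
    obtain ⟨K, -, hK, hKd⟩ := hclique (f x₀)
    obtain ⟨k, hk⟩ := hKd.nonempty
    exact hdomecc K hKd hK k hk ▸ radius_le_eccent
  have hdomcenter : ∀ K : Set V, G.Dominates K → G.IsClique K → K ⊆ G.center :=
    fun K hKd hK k hk => (mem_center_iff k).2 ((hdomecc K hKd hK k hk).trans hrad.symm)
  by_cases hself : ∀ c ∈ G.center, ∃ c' ∈ G.center, c ≠ c' ∧ ¬ G.Adj c c'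
  · exact Or.inl (hGch.centerGraph_selfCentered hG hrad hself)
  right
  push Not at hself
  obtain ⟨u, -, hu'⟩ := hself
  obtain ⟨v, hv⟩ := hf.exists_dist_eq u
  obtain ⟨K, hKv, hK, hKd⟩ := hclique v
  have hKu : ∀ x ∈ K, G.Adj u x := by
    intro x hx
    refine hu' x (hdomcenter K hKd hK hx) ?_
    rintro rfl
    have : H.dist v (f u) ≤ k + 1 := hKv hx
    omega
  have hKdist : ∀ y ∈ f '' K, H.dist v y = k + 1 := by
    rintro _ ⟨x, hx, rfl⟩
    have h1 : H.dist v (f x) ≤ k + 1 := hKv hx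
    have h2 := Adj.dist_le_succ hH (v := v) (f.map_adj_iff.2 (hKu x hx).symm)
    omega
  have hfK : H.IsClique (f '' K) := by
    rintro _ ⟨x, hx, rfl⟩ _ ⟨y, hy, rfl⟩ hxy
    exact f.map_adj_iff.2 (hK hx hy fun h => hxy (congrArg f h))
  -- From `v`, the vertices `u`, `K` and `κ` are at distances `k + 2`, `k + 1` and `k`. If `κ` came
  -- from `G`, it would extend `K` to a dominating clique, so be central in `G` and adjacent to `u`,
  -- too close to `v`.
  obtain ⟨κ, hκ, hκK⟩ := hch.exists_common_adj hH (Set.toFinite _) (hKd.nonempty.image f) hfK hKdist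
  have hκr : κ ∉ Set.range f := by
    rintro ⟨x, rfl⟩
    have hxK : G.IsClique (insert x K) := by
      rw [isClique_insert]
      exact ⟨hK, fun y hy _ => (f.map_adj_iff.1 (hκK _ ⟨y, hy, rfl⟩)).symm⟩
    have hxKd : G.Dominates (insert x K) := by
      intro y hy
      obtain ⟨w, hw, hyw⟩ := hKd y fun h => hy (Set.mem_insert_of_mem _ h)
      exact ⟨w, Set.mem_insert_of_mem _ hw, hyw⟩
    have hux : u ≠ x := by
      rintro rfl
      omega
    have hadj := hu' x (hdomcenter _ hxKd hxK (Set.mem_insert _ _)) hux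
    have := Adj.dist_le_succ hH (v := v) (f.map_adj_iff.2 hadj.symm)
    omega
  -- All of `K` is adjacent to `κ`, hence at distance at least `k + 2` from `w`, while `L` is within
  -- `k + 1`.
  obtain ⟨w, hw⟩ := hf.exists_lt_dist κ hκr
  obtain ⟨L, hLw, hL, hLd⟩ := hclique w
  refine ⟨K, L, ?_, hK, hL, hKd, hLd⟩
  rw [Set.disjoint_left]
  intro x hxK hxL
  have h1 : H.dist w (f x) ≤ k + 1 := hLw hxL
  have h2 := Adj.dist_le_succ hH (v := w) (hκK _ ⟨x, hxK, rfl⟩)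
  omega

end IsCenterEmbedding

theorem IsChordal.of_embedding (hch : H.IsChordal) (f : G ↪g H) : G.IsChordal :=
  fun n hn ⟨e⟩ => hch n hn ⟨f.comp e⟩

theorem IsCenterOfChordal.properties [Finite V] [Nontrivial V] (h : G.IsCenterOfChordal) :
    G.Connected ∧ G.IsChordal ∧ G.ediam ≤ 3 ∧
      ((G.centerGraph.IsSelfCentered ∧ G.centerGraph.radius = 2) ∨
        G.HasTwoDisjointDominatingCliques) := by
  obtain ⟨W, _, H, hH, hch, ⟨e⟩⟩ := h
  obtain ⟨f, r, hf⟩ := exists_isCenterEmbedding hH e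
  have hGch := hch.of_embedding f
  have hG : G.Connected := by
    rw [connected_iff]
    exact ⟨fun x y => ((hf.monoConvex_range hch hH).reachable_and_dist_eq hH x y).1, inferInstance⟩
  refine ⟨hG, hGch, ?_, hf.selfCentered_or_cliques hch hH hGch hG⟩
  rw [ediam_le_iff]
  intro x y
  rw [← (hG x y).coe_dist_eq_edist]
  exact_mod_cast hf.dist_le_three hch hH x y

end SimpleGraph

/-! ### Sufficiency: chordal graphs with prescribed center. -/

namespace SimpleGraph

variable {V W : Type u} {G : SimpleGraph V} {H : SimpleGraph W} {ι : Type u}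

/-- The graph obtained from `G` by adding, for each `i`, a new vertex whose neighbors form `K i`. -/
def attach (G : SimpleGraph V) (K : ι → Set V) : SimpleGraph (V ⊕ ι) where
  Adj a b := match a, b with
    | Sum.inl x, Sum.inl y => G.Adj x y
    | Sum.inl x, Sum.inr i => x ∈ K i
    | Sum.inr i, Sum.inl x => x ∈ K i
    | Sum.inr _, Sum.inr _ => False
  symm := ⟨by
    rintro (x | i) (y | j) h
    · exact G.symm.symm _ _ h
    · exact h
    · exact h
    · exact h⟩
  loopless := ⟨by
    rintro (x | i) h
    · exact G.loopless.irrefl x h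
    · exact h⟩

variable {K : ι → Set V}

@[simp] theorem attach_adj_inl_inl {x y : V} :
    (G.attach K).Adj (Sum.inl x) (Sum.inl y) ↔ G.Adj x y := Iff.rfl

@[simp] theorem attach_adj_inl_inr {x : V} {i : ι} :
    (G.attach K).Adj (Sum.inl x) (Sum.inr i) ↔ x ∈ K i := Iff.rfl

@[simp] theorem attach_adj_inr_inl {x : V} {i : ι} :
    (G.attach K).Adj (Sum.inr i) (Sum.inl x) ↔ x ∈ K i := Iff.rfl

@[simp] theorem attach_adj_inr_inr {i j : ι} :
    (G.attach K).Adj (Sum.inr i) (Sum.inr j) ↔ False := Iff.rfl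

/-- The original graph inside `attach G K`. -/
def attachEmbedding (G : SimpleGraph V) (K : ι → Set V) : G ↪g G.attach K :=
  ⟨⟨Sum.inl, Sum.inl_injective⟩, Iff.rfl⟩

theorem edist_map_le {V W : Type*} {G : SimpleGraph V} {H : SimpleGraph W} (f : G ↪g H) (x y : V) :
    H.edist (f x) (f y) ≤ G.edist x y := by
  by_cases h : G.edist x y = ⊤
  · rw [h]; exact le_top
  · obtain ⟨w, hw⟩ := exists_walk_of_edist_ne_top h
    rw [← hw, ← w.length_map f.toHom]
    exact edist_le _

theorem attach_connected (hG : G.Connected) (hK : ∀ i, (K i).Nonempty) :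
    (G.attach K).Connected := by
  have hne := hG.nonempty
  rw [connected_iff_exists_forall_reachable]
  let x₀ : V := Classical.arbitrary V
  have hinl : ∀ y : V, (G.attach K).Reachable (Sum.inl x₀) (Sum.inl y) :=
    fun y => (hG x₀ y).map (attachEmbedding G K).toHom
  refine ⟨Sum.inl x₀, ?_⟩
  rintro (y | i)
  · exact hinl y
  · obtain ⟨y, hy⟩ := hK i
    exact (hinl y).trans (Adj.reachable (attach_adj_inl_inr.2 hy))

/-- The two cycle neighbors of a new vertex would lie in one clique and form a chord, so an induced
cycle of length above three uses old vertices only. -/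
theorem IsChordal.attach (hch : G.IsChordal) (hK : ∀ i, G.IsClique (K i)) :
    (G.attach K).IsChordal := by
  rintro n hn ⟨e⟩
  have hadj := fun i j : Fin n => (e.map_adj_iff (v := i) (w := j)).trans
    (cycleGraph_adj_iff_val (by omega) i j)
  have hinl : ∀ i, ∃ x, e i = Sum.inl x := by
    intro i
    rcases hei : e i with x | k
    · exact ⟨x, rfl⟩
    exfalso
    have hi := i.isLt
    have hnb : ∀ j : Fin n, (G.attach K).Adj (e i) (e j) → ∃ x ∈ K k, e j = Sum.inl x := by
      intro j hj
      rw [hei] at hj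
      rcases hej : e j with x | l
      · rw [hej] at hj
        exact ⟨x, hj, rfl⟩
      · rw [hej] at hj
        exact hj.elim
    obtain ⟨a, ha⟩ : ∃ a : Fin n, a.val = if i.val + 1 = n then 0 else i.val + 1 :=
      ⟨⟨if i.val + 1 = n then 0 else i.val + 1, by split_ifs <;> omega⟩, rfl⟩
    obtain ⟨b, hb⟩ : ∃ b : Fin n, b.val = if i.val = 0 then n - 1 else i.val - 1 :=
      ⟨⟨if i.val = 0 then n - 1 else i.val - 1, by split_ifs <;> omega⟩, rfl⟩
    obtain ⟨x, hx, hex⟩ := hnb a ((hadj i a).2 (by split_ifs at ha <;> omega))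
    obtain ⟨y, hy, hey⟩ := hnb b ((hadj i b).2 (by split_ifs at hb <;> omega))
    have hab : a ≠ b := by
      rw [Ne, Fin.ext_iff]
      split_ifs at ha hb <;> omega
    have hxy : x ≠ y := by
      rintro rfl
      exact hab (e.injective (hex.trans hey.symm))
    have h := hK k hx hy hxy
    rw [← attach_adj_inl_inl (K := K), ← hex, ← hey, hadj] at h
    split_ifs at ha hb <;> omega
  choose g hg using hinl
  refine hch n hn ⟨⟨⟨g, fun i j h => e.injective ?_⟩, fun {i j} => ?_⟩⟩
  · rw [hg, hg, h]
  · rw [← e.map_adj_iff, hg, hg]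
    rfl

theorem le_edist_of_lipschitz {φ : V → ℕ} (hφ : ∀ a b, G.Adj a b → φ b ≤ φ a + 1) {a : V}
    (ha : φ a = 0) (b : V) : (φ b : ℕ∞) ≤ G.edist a b := by
  by_cases h : G.edist a b = ⊤
  · rw [h]; exact le_top
  obtain ⟨w, hw⟩ := exists_walk_of_edist_ne_top h
  have key : ∀ {c d : V} (w : G.Walk c d), φ d ≤ φ c + w.length := by
    intro c d w
    induction w with
    | nil => simp
    | cons hadj w ih =>
      have := hφ _ _ hadj
      rw [Walk.length_cons]
      omega
  have := key w
  rw [ha, zero_add] at this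
  rw [← hw]
  exact_mod_cast this

theorem nonempty_iso_centerGraph [Nonempty V] (f : G ↪g H) {r : ℕ∞}
    (hin : ∀ x, H.eccent (f x) = r) (hout : ∀ w, w ∉ Set.range f → r < H.eccent w) :
    Nonempty (G ≃g H.centerGraph) := by
  have hrad : H.radius = r := by
    apply le_antisymm
    · exact hin (Classical.arbitrary V) ▸ radius_le_eccent
    · refine le_iInf fun w => ?_
      by_cases hw : w ∈ Set.range f
      · obtain ⟨x, rfl⟩ := hw
        exact (hin x).ge
      · exact (hout w hw).le
  have hrange : Set.range f = H.center := by
    ext w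
    rw [mem_center_iff, hrad]
    constructor
    · rintro ⟨x, rfl⟩
      exact hin x
    · intro h
      by_contra hw
      exact (hout w hw).ne' h
  exact ⟨⟨(Equiv.ofInjective f f.injective).trans (Equiv.setCongr hrange), f.map_adj_iff⟩⟩

theorem isCenterOfChordal_of_disjoint_dominating_cliques [Finite V] [Finite ι] [Nontrivial ι]
    (hG : G.Connected) (hch : G.IsChordal) (hd : G.ediam ≤ 3)
    (hdisj : ∀ i j, i ≠ j → Disjoint (K i) (K j)) (hK : ∀ i, G.IsClique (K i))
    (hdom : ∀ i, G.Dominates (K i)) : G.IsCenterOfChordal := by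
  classical
  have hne := hG.nonempty
  let H₁ : SimpleGraph (V ⊕ ι) := G.attach K
  let H : SimpleGraph ((V ⊕ ι) ⊕ ι) := H₁.attach fun i => {Sum.inr i}
  have hH₁ : H₁.Connected := attach_connected hG fun i => (hdom i).nonempty
  have hH : H.Connected := attach_connected hH₁ fun i => Set.singleton_nonempty _
  have hHch : H.IsChordal := (hch.attach hK).attach fun i => isClique_singleton _
  let f : G ↪g H := (attachEmbedding H₁ _).comp (attachEmbedding G K)
  -- Lower bounds on distances from the `i`th leaf. Disjointness of the cliques is what keeps the
  -- other attached vertices at distance four.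
  have hlower : ∀ i b, ((match b with
      | Sum.inl (Sum.inl x) => if x ∈ K i then 2 else 3
      | Sum.inl (Sum.inr j) => if j = i then 1 else 4
      | Sum.inr j => if j = i then 0 else 5 : ℕ) : ℕ∞) ≤ H.edist (Sum.inr i) b := by
    intro i b
    refine le_edist_of_lipschitz (G := H) (φ := fun b => match b with
      | Sum.inl (Sum.inl x) => if x ∈ K i then 2 else 3
      | Sum.inl (Sum.inr j) => if j = i then 1 else 4
      | Sum.inr j => if j = i then 0 else 5) ?_ (by simp) b
    have hnot : ∀ j x, j ≠ i → x ∈ K j → x ∉ K i :=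
      fun j x hji hx hxi => Set.disjoint_left.1 (hdisj j i hji) hx hxi
    rintro ((x | j) | j) ((y | l) | l) h
    · dsimp only; split_ifs <;> omega
    · have hx : x ∈ K l := h
      have := hnot l x
      dsimp only
      split_ifs <;> first | omega | tauto
    · simp [H] at h
    · have hy : y ∈ K j := h
      have := hnot j y
      dsimp only
      split_ifs with h1 h2 h2 <;> first | omega | tauto | (subst h2; tauto)
    · exact h.elim
    · obtain rfl : j = l := by simpa [H] using h
      dsimp only
      split_ifs <;> omega
    · simp [H] at h
    · obtain rfl : l = j := by simpa [H] using h
      dsimp only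
      split_ifs <;> omega
    · exact h.elim
  have hone : ∀ x i, H.edist (Sum.inl (Sum.inl x)) (Sum.inl (Sum.inr i)) ≤ 2 := by
    intro x i
    by_cases hx : x ∈ K i
    · have : H.Adj (Sum.inl (Sum.inl x)) (Sum.inl (Sum.inr i)) := hx
      rw [edist_eq_one_iff_adj.2 this]
      norm_num
    · obtain ⟨w, hw, hxw⟩ := hdom i x hx
      have h1 : H.Adj (Sum.inl (Sum.inl x)) (Sum.inl (Sum.inl w)) := hxw
      have h2 : H.Adj (Sum.inl (Sum.inl w)) (Sum.inl (Sum.inr i)) := hw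
      refine SimpleGraph.edist_triangle.trans
        (add_le_add (edist_eq_one_iff_adj.2 h1).le (edist_eq_one_iff_adj.2 h2).le) |>.trans ?_
      norm_num
  refine ⟨_, inferInstance, H, hH, hHch, nonempty_iso_centerGraph f (r := 3) ?_ ?_⟩
  · intro x
    apply le_antisymm
    · rw [eccent_le_iff]
      rintro ((y | i) | i)
      · exact (edist_map_le f x y).trans (edist_le_ediam.trans hd)
      · exact (hone x i).trans (by norm_num)
      · have h : H.Adj (Sum.inl (Sum.inr i)) (Sum.inr i) := by simp [H]
        refine SimpleGraph.edist_triangle.trans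
          (add_le_add (hone x i) (edist_eq_one_iff_adj.2 h).le) |>.trans ?_
        norm_num
    · obtain ⟨i, hi⟩ : ∃ i, x ∉ K i := by
        obtain ⟨i, j, hij⟩ := exists_pair_ne ι
        by_contra hall
        push Not at hall
        exact Set.disjoint_left.1 (hdisj i j hij) (hall i) (hall j)
      have h := hlower i (Sum.inl (Sum.inl x))
      dsimp only at h
      rw [if_neg hi, edist_comm] at h
      exact h.trans edist_le_eccent
  · rintro ((y | j) | j) hb
    · exact (hb ⟨y, rfl⟩).elim
    · obtain ⟨i, hij⟩ := exists_ne j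
      have h := hlower i (Sum.inl (Sum.inr j))
      dsimp only at h
      rw [if_neg hij.symm, edist_comm] at h
      exact lt_of_lt_of_le (by norm_num) (h.trans edist_le_eccent)
    · obtain ⟨i, hij⟩ := exists_ne j
      have h := hlower i (Sum.inr j)
      dsimp only at h
      rw [if_neg hij.symm, edist_comm] at h
      exact lt_of_lt_of_le (by norm_num) (h.trans edist_le_eccent)

theorem IsSelfCentered.exists_edist_eq_two [Finite V] (hself : G.centerGraph.IsSelfCentered)
    (hrad : G.centerGraph.radius = 2) (c : G.center) : ∃ c' : G.center, G.edist c c' = 2 := by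
  have hc : G.centerGraph.eccent c = 2 := by
    rw [← hrad, ← mem_center_iff, hself]
    trivial
  obtain ⟨c', hc'⟩ := G.centerGraph.exists_edist_eq_eccent_of_finite c
  rw [hc, edist_eq_two_iff] at hc'
  obtain ⟨hne, hnadj, m, hm, hm'⟩ := hc'
  exact ⟨c', edist_eq_two_iff.2 ⟨fun h => hne (Subtype.ext h), hnadj, m, hm, hm'⟩⟩

/-- Radius three with diameter at most three would make every vertex central, so two central
vertices would be at distance three, against the radius of the center. -/
theorem IsSelfCentered.radius_eq_two [Finite V] [Nonempty V] (hd : G.ediam ≤ 3)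
    (hself : G.centerGraph.IsSelfCentered) (hrad : G.centerGraph.radius = 2) :
    G.radius = 2 := by
  obtain ⟨c, hc⟩ := G.center_nonempty
  have hecc := (mem_center_iff c).1 hc
  have hle : G.radius ≤ 3 := radius_le_ediam.trans hd
  have hge : 2 ≤ G.radius := by
    obtain ⟨c', hc'⟩ := hself.exists_edist_eq_two hrad ⟨c, hc⟩
    rw [← hecc, ← hc']
    exact edist_le_eccent
  have hne : G.radius ≠ 3 := by
    intro h3
    obtain ⟨y, hy⟩ := G.exists_edist_eq_eccent_of_finite c
    have hyc : y ∈ G.center :=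
      (mem_center_iff y).2 (le_antisymm (h3 ▸ eccent_le_ediam.trans hd) radius_le_eccent)
    have h2 : G.centerGraph.edist ⟨c, hc⟩ ⟨y, hyc⟩ ≤ 2 := by
      have : (⟨c, hc⟩ : G.center) ∈ G.centerGraph.center := hself ▸ trivial
      rw [← hrad, ← (mem_center_iff _).1 this]
      exact edist_le_eccent
    have h1 : G.edist c y ≤ 2 :=
      (edist_map_le (Embedding.induce G.center) ⟨c, hc⟩ ⟨y, hyc⟩).trans h2
    rw [hy, hecc, h3] at h1
    exact absurd h1 (by decide)
  obtain ⟨r, hr⟩ := ENat.ne_top_iff_exists.1 (ne_top_of_le_ne_top (by decide) hle)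
  rw [← hr] at hle hge hne ⊢
  norm_cast at *
  omega

theorem isCenterOfChordal_of_isSelfCentered [Finite V] (hG : G.Connected) (hch : G.IsChordal)
    (hd : G.ediam ≤ 3) (hself : G.centerGraph.IsSelfCentered) (hrad : G.centerGraph.radius = 2) :
    G.IsCenterOfChordal := by
  classical
  have hne := hG.nonempty
  have hr := hself.radius_eq_two hd hrad
  have htwo := hself.exists_edist_eq_two hrad
  let H : SimpleGraph (V ⊕ G.center) := G.attach fun c => {(c : V)}
  have hH : H.Connected := attach_connected hG fun c => Set.singleton_nonempty _
  have hHch : H.IsChordal := hch.attach fun c => isClique_singleton _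
  let f : G ↪g H := attachEmbedding G _
  have hedist : ∀ a b, G.edist a b = G.dist a b := fun a b => ((hG a b).coe_dist_eq_edist).symm
  have hstep : ∀ v a b, G.Adj a b → G.dist v b ≤ G.dist v a + 1 :=
    fun v a b h => h.dist_le_succ hG
  have hpendant : ∀ (c : G.center) b, ((match b with
      | Sum.inl x => G.dist c x + 1
      | Sum.inr d => if d = c then 0 else G.dist c d + 2 : ℕ) : ℕ∞) ≤ H.edist (Sum.inr c) b := by
    intro c b
    refine le_edist_of_lipschitz (G := H) (φ := fun b => match b with
      | Sum.inl x => G.dist c x + 1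
      | Sum.inr d => if d = c then 0 else G.dist c d + 2) ?_ (by simp) b
    rintro (x | d) (y | e) h
    · have := hstep c x y h
      dsimp only
      omega
    · obtain rfl : x = e := h
      dsimp only
      split_ifs <;> omega
    · obtain rfl : y = d := h
      dsimp only
      split_ifs with hdc
      · subst hdc
        simp
      · omega
    · exact h.elim
  have hbase : ∀ x b, ((match b with
      | Sum.inl y => G.dist x y
      | Sum.inr d => G.dist x d + 1 : ℕ) : ℕ∞) ≤ H.edist (Sum.inl x) b := by
    intro x b
    refine le_edist_of_lipschitz (G := H) (φ := fun b => match b with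
      | Sum.inl y => G.dist x y
      | Sum.inr d => G.dist x d + 1) ?_ (by simp) b
    rintro (y | d) (z | e) h
    · exact hstep x y z h
    · obtain rfl : y = e := h
      exact le_rfl
    · obtain rfl : z = d := h
      dsimp only
      omega
    · exact h.elim
  have hdtwo : ∀ c : G.center, ∃ d : G.center, d ≠ c ∧ G.dist d c = 2 := by
    intro c
    obtain ⟨d, hd⟩ := htwo c
    have h2 : G.dist d c = 2 := by
      rw [edist_comm, hedist] at hd
      exact_mod_cast hd
    refine ⟨d, ?_, h2⟩
    rintro rfl
    simp at h2
  refine ⟨_, inferInstance, H, hH, hHch, nonempty_iso_centerGraph f (r := 3) ?_ ?_⟩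
  · intro x
    apply le_antisymm
    · rw [eccent_le_iff]
      rintro (y | c)
      · exact (edist_map_le f x y).trans (edist_le_ediam.trans hd)
      · have h : H.Adj (Sum.inl c) (Sum.inr c) := by simp [H]
        have hxc : G.edist x c ≤ 2 := by
          rw [edist_comm, ← hr, ← (mem_center_iff _).1 c.2]
          exact edist_le_eccent
        refine SimpleGraph.edist_triangle.trans (add_le_add ((edist_map_le f x c).trans hxc)
          (edist_eq_one_iff_adj.2 h).le) |>.trans ?_
        norm_num
    -- A central vertex is at distance three from the leaf of a central vertex two away; any other
    -- vertex already has eccentricity at least three in `G`.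
    · by_cases hx : x ∈ G.center
      · obtain ⟨d, -, hd⟩ := hdtwo ⟨x, hx⟩
        have h := hpendant d (Sum.inl x)
        simp only [hd] at h
        rw [edist_comm] at h
        exact h.trans edist_le_eccent
      · obtain ⟨y, hy⟩ := G.exists_edist_eq_eccent_of_finite x
        have hlt : G.radius < G.eccent x :=
          lt_of_le_of_ne radius_le_eccent fun h => hx ((mem_center_iff x).2 h.symm)
        rw [hr, ← hy, hedist] at hlt
        have h3 : 3 ≤ G.dist x y := by
          have : 2 < G.dist x y := by exact_mod_cast hlt
          exact this
        have h := hbase x (Sum.inl y)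
        refine le_trans ?_ (h.trans edist_le_eccent)
        exact_mod_cast h3
  · rintro (y | c) hb
    · exact (hb ⟨y, rfl⟩).elim
    · obtain ⟨d, hdc, hd⟩ := hdtwo c
      have h := hpendant d (Sum.inr c)
      simp only [if_neg hdc.symm, hd] at h
      rw [edist_comm] at h
      exact lt_of_lt_of_le (by norm_num) (h.trans edist_le_eccent)

theorem HasTwoDisjointDominatingCliques.isCenterOfChordal [Finite V] (hG : G.Connected)
    (hch : G.IsChordal) (hd : G.ediam ≤ 3) (h : G.HasTwoDisjointDominatingCliques) :
    G.IsCenterOfChordal := by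
  obtain ⟨A, B, hAB, hA, hB, hAd, hBd⟩ := h
  -- `ULift` puts the two-element index type in the universe of `V`.
  refine isCenterOfChordal_of_disjoint_dominating_cliques (ι := ULift Bool)
    (K := fun i => if i.down then A else B) hG hch hd ?_ ?_ ?_
  · rintro ⟨_ | _⟩ ⟨_ | _⟩ hij
    · exact (hij rfl).elim
    · exact hAB.symm
    · exact hAB
    · exact (hij rfl).elim
  · rintro ⟨_ | _⟩
    · exact hB
    · exact hA
  · rintro ⟨_ | _⟩
    · exact hBd
    · exact hAd

end SimpleGraph

theorem theorem3 {V : Type u} [Finite V] [Nontrivial V] (G : SimpleGraph V) :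
    G.IsCenterOfChordal ↔
      G.Connected ∧ G.IsChordal ∧ G.ediam ≤ 3 ∧
        ((G.centerGraph.IsSelfCentered ∧ G.centerGraph.radius = 2) ∨
          G.HasTwoDisjointDominatingCliques) := by
  refine ⟨fun h => h.properties, ?_⟩
  rintro ⟨hG, hch, hd, ⟨hself, hrad⟩ | h⟩
  · exact SimpleGraph.isCenterOfChordal_of_isSelfCentered hG hch hd hself hrad
  · exact h.isCenterOfChordal hG hch hd
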